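/- Let $N,d\ge 1$ be integers, $D=\{1,\dots,d\}$, let $\lambda,\mu>0$, and let $C=(c_{l,j})_{l,j\in D}$ be a stochastic matrix ($c_{l,j}\ge 0$, $\sum_{j\in D} c_{l,j}=1$ for all $l$). Consider the multi-type Ehrenfest model: a time-homogeneous continuous-time Markov chain with state space $\{0,1,\dots,N\}\times D$, where $(k,j)$ with $k\ge 1$ means that the system contains $k$ particles, all of type $j$, and $(0,l)$ means that the system is empty and that the last particle in it was of type $l$. Its transition rates are $$(k,j)\to(k-1,j):\ \mu(N+k)\ (1\le k\le N),\qquad (k,j)\to(k+1,j):\ \lambda(N-k)\ (1\le k<N),\qquad (0,l)\to(1,j):\ c_{l,j}\,\lambda N,$$ all other rates being $0$. Fix $l_0\in D$, let the chain start from $(0,l_0)$, and let $p(0,t)$ be the probability that the system is empty at time $t$, and $\rho(0)=\lim_{t\to+\infty}p(0,t)$. Suppose $\lambda=\mu$, and put $$Q(x)=\prod_{r=0}^{N-1}\bigl[x+2\mu(2r+1)\bigr],\qquad P(x)=x\left[\prod_{r=0}^{N-1}\bigl(x+2\mu(2r+1)\bigr)+\prod_{r=0}^{N-1}\bigl(x+2\mu(2r+2)\bigr)\right].$$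 Then $P$ has $N+1$ distinct real roots $0=\alpha_1>\alpha_2>\dots>\alpha_{N+1}$, the limit $\rho(0)$ exists, and for all $t\ge 0$ $$p(0,t)=\rho(0)+2\sum_{k=2}^{N+1}\frac{Q(\alpha_k)}{\beta_k}\,e^{\alpha_k t},$$ where $$\rho(0)=\frac{2\binom{2N}{N}}{\binom{2N}{N}+4^N}=\frac{2}{1+\dfrac{\sqrt{\pi}\,N!}{\Gamma(N+1/2)}},\qquad \beta_k=\lim_{\eta\to\alpha_k}\frac{P(\eta)}{\eta-\alpha_k}=2\prod_{\substack{s=1\\ s\ne k}}^{N+1}(\alpha_k-\alpha_s),\quad k=1,\dots,N+1.$$ -/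

import Mathlib

open MeasureTheory ProbabilityTheory Filter Topology
open scoped NNReal

noncomputable section

namespace MultiTypeEhrenfest

/-- States of the multi-type Ehrenfest chain with capacity `N` and type set `D = Fin d`.
For `k ≥ 1`, `(k, j)` means that the system holds `k` particles of type `j`; `(0, l)` means that the
system is empty and that the last particle in it was of type `l`. -/
abbrev State (N d : ℕ) : Type := Fin (N + 1) × Fin d

/-- Off-diagonal transition rates `q(x; y)`, for `x ≠ y` :
* from `(0, l)` to `(1, j)` : `c l j * lam * N`;
* from `(k, j)` to `(k - 1, j)`, `1 ≤ k ≤ N` : `mu * (N + k)`;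
* from `(k, j)` to `(k + 1, j)`, `1 ≤ k < N` : `lam * (N - k)`;
* all the others : `0`. -/
def rate {N d : ℕ} (lam mu : ℝ) (c : Matrix (Fin d) (Fin d) ℝ) (x y : State N d) : ℝ :=
  if (x.1 : ℕ) = 0 then
    if (y.1 : ℕ) = 1 then c x.2 y.2 * lam * (N : ℝ) else 0
  else if y.2 = x.2 then
    if (y.1 : ℕ) + 1 = (x.1 : ℕ) then mu * ((N : ℝ) + ((x.1 : ℕ) : ℝ))
    else if (y.1 : ℕ) = (x.1 : ℕ) + 1 then lam * ((N : ℝ) - ((x.1 : ℕ) : ℝ))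
    else 0
  else 0

/-- `X` is, under the probability `Pr`, a time-homogeneous continuous-time Markov chain whose
transition rates are those of the multi-type Ehrenfest model. The initial law is arbitrary. -/
structure IsChain {N d : ℕ} (lam mu : ℝ) (c : Matrix (Fin d) (Fin d) ℝ)
    {Ω : Type*} [MeasurableSpace Ω] (Pr : Measure Ω) (X : ℝ≥0 → Ω → State N d) : Prop where
  measurable : ∀ t : ℝ≥0, Measurable (X t)
  /-- Markov property: given the present state, the finite-dimensional past is irrelevant. -/
  markov : ∀ (n : ℕ) (s : Fin n → ℝ≥0) (t h : ℝ≥0) (w : Fin n → State N d) (x y : State N d),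
    (∀ i, s i ≤ t) →
    Pr ({ω | X t ω = x} ∩ {ω | ∀ i, X (s i) ω = w i}) ≠ 0 →
    (cond Pr ({ω | X t ω = x} ∩ {ω | ∀ i, X (s i) ω = w i})).real {ω | X (t + h) ω = y} =
      (cond Pr {ω | X t ω = x}).real {ω | X (t + h) ω = y}
  /-- Time-homogeneity of the transition probabilities. -/
  homogeneous : ∀ (s t h : ℝ≥0) (x y : State N d),
    Pr {ω | X s ω = x} ≠ 0 → Pr {ω | X t ω = x} ≠ 0 →
    (cond Pr {ω | X s ω = x}).real {ω | X (s + h) ω = y} =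
      (cond Pr {ω | X t ω = x}).real {ω | X (t + h) ω = y}
  /-- Transition rates: `lim_{h → 0+} Pr (X (t + h) = y | X t = x) / h = q(x; y)`. -/
  rates : ∀ (t : ℝ≥0) (x y : State N d), x ≠ y → Pr {ω | X t ω = x} ≠ 0 →
    Tendsto (fun h : ℝ≥0 => (cond Pr {ω | X t ω = x}).real {ω | X (t + h) ω = y} / (h : ℝ))
      (𝓝[>] 0) (𝓝 (rate lam mu c x y))

/-- `p(0, t)` : the probability that the system is empty at time `t`, given that it is empty at
time `0` and that the last particle before time `0` was of type `l₀`. -/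
def emptyProb {N d : ℕ} {Ω : Type*} [MeasurableSpace Ω] (Pr : Measure Ω)
    (X : ℝ≥0 → Ω → State N d) (l₀ : Fin d) (t : ℝ≥0) : ℝ :=
  (cond Pr {ω | X 0 ω = (0, l₀)}).real {ω | (X t ω).1 = 0}

/-- `Q(x) = ∏_{r=0}^{N-1} (x + 2 mu (2r+1))`. -/
def polyQ (N : ℕ) (mu : ℝ) : Polynomial ℝ :=
  ∏ r ∈ Finset.range N, (Polynomial.X + Polynomial.C (2 * mu * (2 * (r : ℝ) + 1)))

/-- `P(x) = x (∏_{r=0}^{N-1} (x + 2 mu (2r+1)) + ∏_{r=0}^{N-1} (x + 2 mu (2r+2)))`. -/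
def polyP (N : ℕ) (mu : ℝ) : Polynomial ℝ :=
  Polynomial.X *
    (∏ r ∈ Finset.range N, (Polynomial.X + Polynomial.C (2 * mu * (2 * (r : ℝ) + 1))) +
      ∏ r ∈ Finset.range N, (Polynomial.X + Polynomial.C (2 * mu * (2 * (r : ℝ) + 2))))

end MultiTypeEhrenfest

end

namespace MultiTypeEhrenfest

open Polynomial in
/-- Monic rescaled Krawtchouk polynomials of a `2N`-step Ehrenfest urn with flip rate `mu`. -/
noncomputable def kraw (N : ℕ) (mu : ℝ) : ℕ → ℝ[X]
  | 0 => 1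
  | 1 => X + C (2 * N * mu)
  | m + 2 => (X + C (2 * N * mu)) * kraw N mu (m + 1) -
      C ((2 * N - m) * (m + 1) * mu ^ 2) * kraw N mu m

section Krawtchouk

open Polynomial

lemma kraw_monic_natDegree (N : ℕ) (mu : ℝ) (m : ℕ) :
    ((kraw N mu m).Monic ∧ (kraw N mu m).natDegree = m) ∧
      ((kraw N mu (m + 1)).Monic ∧ (kraw N mu (m + 1)).natDegree = m + 1) := by
  induction m with
  | zero => exact ⟨⟨monic_one, natDegree_one⟩, monic_X_add_C _, natDegree_X_add_C _⟩
  | succ m ih =>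
    obtain ⟨⟨h1, h2⟩, h3, h4⟩ := ih
    refine ⟨⟨h3, h4⟩, ?_⟩
    have hm : ((X + C (2 * N * mu)) * kraw N mu (m + 1)).Monic := (monic_X_add_C _).mul h3
    have hd : ((X + C (2 * N * mu)) * kraw N mu (m + 1)).natDegree = m + 2 := by
      rw [(monic_X_add_C _).natDegree_mul h3, natDegree_X_add_C, h4]; ring
    have hlt : (C ((2 * N - m) * (m + 1) * mu ^ 2) * kraw N mu m).natDegree <
        ((X + C (2 * N * mu)) * kraw N mu (m + 1)).natDegree := by
      have := natDegree_C_mul_le ((2 * N - m) * (m + 1) * mu ^ 2) (kraw N mu m)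
      omega
    refine ⟨hm.sub_of_left (degree_lt_degree hlt), ?_⟩
    rw [kraw, natDegree_sub_eq_left_of_natDegree_lt hlt, hd]

lemma kraw_monic (N : ℕ) (mu : ℝ) (m : ℕ) : (kraw N mu m).Monic :=
  (kraw_monic_natDegree N mu m).1.1

lemma kraw_natDegree (N : ℕ) (mu : ℝ) (m : ℕ) : (kraw N mu m).natDegree = m :=
  (kraw_monic_natDegree N mu m).1.2

lemma derivative_one_sub_pow_mul_one_add_pow (i j : ℕ) :
    (1 - X ^ 2) * derivative ((1 - X) ^ i * (1 + X) ^ j : ℝ[X]) =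
      (C ((j : ℝ) - i) - C ((i : ℝ) + j) * X) * ((1 - X) ^ i * (1 + X) ^ j) := by
  have h1 : (1 - X) * derivative ((1 - X) ^ i : ℝ[X]) = - C (i : ℝ) * (1 - X) ^ i := by
    cases i with
    | zero => simp
    | succ i => simp [derivative_pow]; ring
  have h2 : (1 + X) * derivative ((1 + X) ^ j : ℝ[X]) = C (j : ℝ) * (1 + X) ^ j := by
    cases j with
    | zero => simp
    | succ j => simp [derivative_pow]; ring
  rw [derivative_mul]
  simp only [map_sub, map_add]
  linear_combination ((1 + X) * (1 + X) ^ j) * h1 + ((1 - X) * (1 - X) ^ i) * h2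

lemma coeff_zero_one_sub_pow_mul_one_add_pow (i j : ℕ) :
    ((1 - X) ^ i * (1 + X) ^ j : ℝ[X]).coeff 0 = 1 := by
  simp [coeff_zero_eq_eval_zero]

lemma coeff_one_one_sub_pow_mul_one_add_pow (i j : ℕ) :
    ((1 - X) ^ i * (1 + X) ^ j : ℝ[X]).coeff 1 = j - i := by
  have h := congrArg (fun p : ℝ[X] => p.coeff 0) (derivative_one_sub_pow_mul_one_add_pow i j)
  have h0 := coeff_zero_one_sub_pow_mul_one_add_pow i j
  generalize ((1 - X) ^ i * (1 + X) ^ j : ℝ[X]) = f at h h0 ⊢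
  simp only [mul_coeff_zero, coeff_derivative, h0] at h
  simpa using h

lemma coeff_add_two_one_sub_pow_mul_one_add_pow (i j m : ℕ) :
    ((m : ℝ) + 2) * ((1 - X) ^ i * (1 + X) ^ j : ℝ[X]).coeff (m + 2) =
      ((j : ℝ) - i) * ((1 - X) ^ i * (1 + X) ^ j : ℝ[X]).coeff (m + 1) -
        ((i : ℝ) + j - m) * ((1 - X) ^ i * (1 + X) ^ j : ℝ[X]).coeff m := by
  have h := congrArg (fun p : ℝ[X] => p.coeff (m + 1))
    (derivative_one_sub_pow_mul_one_add_pow i j)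
  generalize ((1 - X) ^ i * (1 + X) ^ j : ℝ[X]) = f at h ⊢
  have e1 : (1 - X ^ 2) * derivative f = derivative f - derivative f * X ^ 1 * X := by ring
  have e2 : (C ((j : ℝ) - i) - C ((i : ℝ) + j) * X) * f =
      C ((j : ℝ) - i) * f - C ((i : ℝ) + j) * (f * X) := by ring
  simp only [e1, e2, coeff_sub, coeff_mul_X, coeff_C_mul, coeff_derivative] at h
  cases m with
  | zero =>
    simp only [pow_one, mul_coeff_zero, coeff_X_zero, mul_zero] at h
    push_cast at h ⊢
    linear_combination h
  | succ m =>
    simp only [pow_one, coeff_mul_X, coeff_derivative] at h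
    push_cast at h ⊢
    linear_combination h

lemma reflect_pow {R : Type*} [CommSemiring R] (p : R[X]) (hp : p.natDegree ≤ 1) (n : ℕ) :
    reflect n (p ^ n) = reflect 1 p ^ n := by
  induction n with
  | zero => simp
  | succ n ih =>
    rw [pow_succ, pow_succ, reflect_mul _ _ ((natDegree_pow_le_of_le n hp).trans (by simp)) hp, ih]

lemma coeff_reflect_one_sub_pow_mul_one_add_pow (i j m : ℕ) (hm : m ≤ i + j) :
    ((1 - X) ^ i * (1 + X) ^ j : ℝ[X]).coeff (i + j - m) =
      (-1) ^ i * ((1 - X) ^ i * (1 + X) ^ j : ℝ[X]).coeff m := by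
  have d1 : (1 - X : ℝ[X]).natDegree ≤ 1 := by compute_degree
  have d2 : (1 + X : ℝ[X]).natDegree ≤ 1 := by compute_degree
  have rX : reflect 1 (X : ℝ[X]) = 1 := by simp
  have r1 : reflect 1 (1 : ℝ[X]) = X := by simp
  have h1 : reflect 1 (1 - X : ℝ[X]) = -1 * (1 - X) := by
    rw [reflect_sub, rX, r1]; ring
  have h2 : reflect 1 (1 + X : ℝ[X]) = 1 + X := by
    rw [reflect_add, rX, r1]; ring
  have h : reflect (i + j) ((1 - X) ^ i * (1 + X) ^ j : ℝ[X]) =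
      C ((-1) ^ i) * ((1 - X) ^ i * (1 + X) ^ j) := by
    rw [reflect_mul _ _ ((natDegree_pow_le_of_le i d1).trans (by simp))
      ((natDegree_pow_le_of_le j d2).trans (by simp)), reflect_pow _ d1, reflect_pow _ d2, h1, h2,
      mul_pow]
    simp [mul_assoc]
  have h' := congrArg (fun p : ℝ[X] => p.coeff m) h
  simpa only [coeff_reflect, revAt_le hm, coeff_C_mul] using h'

lemma eval_kraw (N : ℕ) (mu : ℝ) (i j : ℕ) (hij : i + j = 2 * N) (m : ℕ) :
    (kraw N mu m).eval (-2 * mu * i) =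
      m.factorial * mu ^ m * ((1 - X) ^ i * (1 + X) ^ j : ℝ[X]).coeff m := by
  have hij' : (i : ℝ) + j = 2 * N := by exact_mod_cast hij
  induction m using Nat.strong_induction_on with
  | _ m ih =>
    match m with
    | 0 => rw [coeff_zero_one_sub_pow_mul_one_add_pow]; simp [kraw]
    | 1 =>
      rw [coeff_one_one_sub_pow_mul_one_add_pow]
      simp [kraw]
      linear_combination -mu * hij'
    | m + 2 =>
      have hr := coeff_add_two_one_sub_pow_mul_one_add_pow i j m
      simp only [kraw, eval_sub, eval_mul, eval_add, eval_X, eval_C, ih (m + 1) (by omega),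
        ih m (by omega), Nat.factorial_succ]
      push_cast
      generalize ((1 - X) ^ i * (1 + X) ^ j : ℝ[X]) = f at hr ⊢
      have hj : (j : ℝ) = 2 * N - i := by linarith
      rw [hj] at hr
      linear_combination -((m + 1) * m.factorial * mu ^ (m + 2)) * hr

lemma polyQ_eq_prod_sub (N : ℕ) (mu : ℝ) :
    polyQ N mu = ∏ r ∈ Finset.range N, (X - C (-2 * mu * ((2 * r + 1 : ℕ) : ℝ))) := by
  refine Finset.prod_congr rfl fun r _ => ?_
  rw [sub_eq_add_neg, ← C_neg]
  push_cast
  ring_nf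

lemma polyQ_monic (N : ℕ) (mu : ℝ) : (polyQ N mu).Monic :=
  monic_prod_of_monic _ _ fun _ _ => monic_X_add_C _

lemma polyQ_natDegree (N : ℕ) (mu : ℝ) : (polyQ N mu).natDegree = N := by
  rw [polyQ, natDegree_prod_of_monic _ _ fun _ _ => monic_X_add_C _]
  simp only [natDegree_X_add_C, Finset.sum_const, Finset.card_range, smul_eq_mul, mul_one]

lemma degree_sub_lt_of_coeff {p q : ℝ[X]} {n : ℕ} (hp : p.natDegree ≤ n) (hq : q.natDegree ≤ n)
    (h : p.coeff n = q.coeff n) : (p - q).degree < n := by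
  rw [degree_lt_iff_coeff_zero]
  intro m hm
  rcases hm.eq_or_lt with rfl | hm
  · simp [h]
  · rw [coeff_sub, coeff_eq_zero_of_natDegree_lt (by omega),
      coeff_eq_zero_of_natDegree_lt (by omega), sub_zero]

/-- The middle Krawtchouk polynomial is `Q`. -/
lemma kraw_middle (N : ℕ) {mu : ℝ} (hmu : 0 < mu) : kraw N mu N = polyQ N mu := by
  refine eq_of_degree_sub_lt_of_eval_index_eq (s := Finset.range N)
    (v := fun r : ℕ => -2 * mu * ((2 * r + 1 : ℕ) : ℝ)) ?_ ?_ ?_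
  · intro a _ b _ hab
    have h2 : (-2 * mu) ≠ 0 := by simpa using hmu.ne'
    have := mul_left_cancel₀ h2 hab
    norm_cast at this
    omega
  · rw [Finset.card_range]
    refine degree_sub_lt_of_coeff (kraw_natDegree ..).le (polyQ_natDegree ..).le ?_
    have h1 := (kraw_monic N mu N).coeff_natDegree
    have h2 := (polyQ_monic N mu).coeff_natDegree
    rw [kraw_natDegree] at h1
    rw [polyQ_natDegree] at h2
    rw [h1, h2]
  · intro r hr
    rw [Finset.mem_range] at hr
    have hc := coeff_reflect_one_sub_pow_mul_one_add_pow (2 * r + 1) (2 * N - (2 * r + 1)) N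
      (by omega)
    rw [show 2 * r + 1 + (2 * N - (2 * r + 1)) - N = N by omega, Odd.neg_one_pow ⟨r, rfl⟩] at hc
    rw [eval_kraw N mu (2 * r + 1) (2 * N - (2 * r + 1)) (by omega), polyQ_eq_prod_sub, eval_prod,
      Finset.prod_eq_zero (Finset.mem_range.2 hr) (by simp)]
    have : ((1 - X) ^ (2 * r + 1) * (1 + X) ^ (2 * N - (2 * r + 1)) : ℝ[X]).coeff N = 0 := by
      linarith
    rw [this, mul_zero]

lemma polyP_eq (N : ℕ) (mu : ℝ) :
    polyP N mu = X * (polyQ N mu +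
      ∏ r ∈ Finset.range N, (X + C (2 * mu * (2 * (r : ℝ) + 2)))) := rfl

lemma polyP_natDegree_coeff (N : ℕ) (mu : ℝ) :
    (polyP N mu).natDegree ≤ N + 1 ∧ (polyP N mu).coeff (N + 1) = 2 := by
  set R : ℝ[X] := ∏ r ∈ Finset.range N, (X + C (2 * mu * (2 * (r : ℝ) + 2))) with hR
  have hRm : R.Monic := monic_prod_of_monic _ _ fun _ _ => monic_X_add_C _
  have hRd : R.natDegree = N := by
    rw [hR, natDegree_prod_of_monic _ _ fun _ _ => monic_X_add_C _]
    simp only [natDegree_X_add_C, Finset.sum_const, Finset.card_range, smul_eq_mul, mul_one]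
  have h1 := hRm.coeff_natDegree
  have h2 := (polyQ_monic N mu).coeff_natDegree
  rw [hRd] at h1
  rw [polyQ_natDegree] at h2
  rw [polyP_eq, ← hR]
  constructor
  · refine natDegree_mul_le.trans ?_
    have := natDegree_add_le_of_degree_le (polyQ_natDegree N mu).le hRd.le
    simp only [natDegree_X]
    omega
  · rw [coeff_X_mul, coeff_add, h1, h2]; norm_num

/-- Boundary equation at the empty state, in terms of Krawtchouk polynomials. -/
lemma polyP_eq_kraw (n : ℕ) {mu : ℝ} (hmu : 0 < mu) :
    polyP (n + 1) mu = C 2 * ((X + C (mu * (n + 1 : ℕ))) * polyQ (n + 1) mu -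
      C ((n + 2) * (n + 1) * mu ^ 2) * kraw (n + 1) mu n) := by
  obtain ⟨hPd, hPc⟩ := polyP_natDegree_coeff (n + 1) mu
  have hm : ((X + C (mu * (n + 1 : ℕ))) * polyQ (n + 1) mu).Monic :=
    (monic_X_add_C _).mul (polyQ_monic _ _)
  have hd : ((X + C (mu * (n + 1 : ℕ))) * polyQ (n + 1) mu).natDegree = n + 2 := by
    rw [(monic_X_add_C _).natDegree_mul (polyQ_monic _ _), natDegree_X_add_C, polyQ_natDegree]
    ring
  have hk : (C ((n + 2) * (n + 1) * mu ^ 2) * kraw (n + 1) mu n).natDegree ≤ n :=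
    (natDegree_C_mul_le _ _).trans (kraw_natDegree ..).le
  refine eq_of_degree_sub_lt_of_eval_index_eq (s := Finset.range (n + 2))
    (v := fun r : ℕ => -2 * mu * ((2 * r : ℕ) : ℝ)) ?_ ?_ ?_
  · intro a _ b _ hab
    have h2 : (-2 * mu) ≠ 0 := by simpa using hmu.ne'
    have := mul_left_cancel₀ h2 hab
    norm_cast at this
    omega
  · rw [Finset.card_range]
    refine degree_sub_lt_of_coeff hPd ?_ ?_
    · refine (natDegree_C_mul_le _ _).trans ((natDegree_sub_le _ _).trans ?_)
      rw [hd]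
      exact max_le le_rfl (by omega)
    · rw [hPc, coeff_C_mul, coeff_sub, coeff_eq_zero_of_natDegree_lt (p := C _ * _) (by omega)]
      have := hm.coeff_natDegree
      rw [hd] at this
      rw [this]; norm_num
  · intro r hr
    rw [Finset.mem_range] at hr
    have hc := coeff_reflect_one_sub_pow_mul_one_add_pow (2 * r) (2 * (n + 1) - 2 * r) n
      (by omega)
    rw [show 2 * r + (2 * (n + 1) - 2 * r) - n = n + 2 by omega,
      (even_two_mul r).neg_one_pow, one_mul] at hc
    have e1 := eval_kraw (n + 1) mu (2 * r) (2 * (n + 1) - 2 * r) (by omega) n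
    have e2 := eval_kraw (n + 1) mu (2 * r) (2 * (n + 1) - 2 * r) (by omega) (n + 2)
    rw [hc] at e2
    simp only [kraw, kraw_middle _ hmu] at e2
    have hz : (polyP (n + 1) mu).eval (-2 * mu * ((2 * r : ℕ) : ℝ)) =
        (-2 * mu * ((2 * r : ℕ) : ℝ)) * (polyQ (n + 1) mu).eval (-2 * mu * ((2 * r : ℕ) : ℝ)) := by
      rw [polyP_eq, eval_mul, eval_X, eval_add, eval_prod]
      rcases r with _ | r
      · simp
      · rw [Finset.prod_eq_zero (i := r) (Finset.mem_range.2 (by omega)), add_zero]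
        simp only [eval_add, eval_X, eval_C]
        push_cast
        ring
    rw [hz]
    simp only [eval_mul, eval_sub, eval_add, eval_X, eval_C] at e2 ⊢
    generalize ((1 - X) ^ (2 * r) * (1 + X) ^ (2 * (n + 1) - 2 * r) : ℝ[X]) = f at *
    simp only [Nat.factorial_succ] at e2
    push_cast at *
    linear_combination -e2 + ((n + 2) * (n + 1) * mu ^ 2) * e1

end Krawtchouk

end MultiTypeEhrenfest

namespace MultiTypeEhrenfest

section Roots

open Polynomial

lemma neg_one_pow_mul_prod_pos {f : ℕ → ℝ} {r N : ℕ} (hr : r ≤ N) (hneg : ∀ i < r, f i < 0)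
    (hpos : ∀ i, r ≤ i → 0 < f i) : 0 < (-1) ^ r * ∏ i ∈ Finset.range N, f i := by
  obtain ⟨q, rfl⟩ := Nat.exists_eq_add_of_le hr
  have h : (-1 : ℝ) ^ r * ∏ i ∈ Finset.range (r + q), f i =
      (∏ i ∈ Finset.range r, -f i) * ∏ i ∈ Finset.range q, f (r + i) := by
    rw [Finset.prod_range_add, Finset.prod_neg, Finset.card_range]; ring
  rw [h]
  exact mul_pos (Finset.prod_pos fun i hi => neg_pos.2 (hneg i (Finset.mem_range.1 hi)))
    (Finset.prod_pos fun i _ => hpos _ (by omega))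

lemma exists_root_polyP (N : ℕ) {mu : ℝ} (hmu : 0 < mu) {r : ℕ} (hr : r < N) :
    ∃ x ∈ Set.Ioo (-2 * mu * (2 * r + 2)) (-2 * mu * (2 * r + 1)), (polyP N mu).eval x = 0 := by
  set R : ℝ[X] := ∏ r ∈ Finset.range N, (X + C (2 * mu * (2 * (r : ℝ) + 2))) with hR
  have hQe (x : ℝ) : (polyQ N mu).eval x =
      ∏ i ∈ Finset.range N, (x + 2 * mu * (2 * (i : ℝ) + 1)) := by
    simp only [polyQ, eval_prod, eval_add, eval_X, eval_C]
  have hRe (x : ℝ) : R.eval x = ∏ i ∈ Finset.range N, (x + 2 * mu * (2 * (i : ℝ) + 2)) := by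
    simp only [hR, eval_prod, eval_add, eval_X, eval_C]
  have hb : 0 < (-1) ^ r * (polyQ N mu + R).eval (-2 * mu * (2 * r + 1)) := by
    have h0 : (polyQ N mu).eval (-2 * mu * (2 * r + 1)) = 0 := by
      rw [hQe]; exact Finset.prod_eq_zero (Finset.mem_range.2 hr) (by ring)
    rw [eval_add, h0, zero_add, hRe]
    refine neg_one_pow_mul_prod_pos hr.le (fun i hi => ?_) fun i hi => ?_
    · have : (i : ℝ) + 1 ≤ r := by exact_mod_cast hi
      nlinarith
    · have : (r : ℝ) ≤ i := by exact_mod_cast hi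
      nlinarith
  have ha : 0 < (-1) ^ (r + 1) * (polyQ N mu + R).eval (-2 * mu * (2 * r + 2)) := by
    have h0 : R.eval (-2 * mu * (2 * r + 2)) = 0 := by
      rw [hRe]; exact Finset.prod_eq_zero (Finset.mem_range.2 hr) (by ring)
    rw [eval_add, h0, add_zero, hQe]
    refine neg_one_pow_mul_prod_pos (Nat.succ_le_of_lt hr) (fun i hi => ?_) fun i hi => ?_
    · have : (i : ℝ) ≤ r := by exact_mod_cast Nat.lt_succ_iff.1 hi
      nlinarith
    · have : (r : ℝ) + 1 ≤ i := by exact_mod_cast hi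
      nlinarith
  rw [pow_succ, mul_neg_one, neg_mul, neg_pos] at ha
  obtain ⟨x, hx, hx0⟩ := intermediate_value_Ioo (by nlinarith)
    (f := fun x => (-1) ^ r * (polyQ N mu + R).eval x) (by fun_prop) ⟨ha, hb⟩
  refine ⟨x, hx, ?_⟩
  rw [polyP_eq, eval_mul, (mul_eq_zero.1 hx0).resolve_left (by simp), mul_zero]

lemma exists_strictAnti_roots (N : ℕ) {mu : ℝ} (hmu : 0 < mu) :
    ∃ α : Fin (N + 1) → ℝ, α 0 = 0 ∧ StrictAnti α ∧ ∀ k, (polyP N mu).eval (α k) = 0 := by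
  choose a ha ha0 using fun r : Fin N => exists_root_polyP N hmu r.2
  refine ⟨Fin.cons 0 a, rfl, ?_, ?_⟩
  · intro i j hij
    induction j using Fin.cases with
    | zero => exact absurd hij (Fin.not_lt_zero i)
    | succ j =>
      have hj := (ha j).2
      induction i using Fin.cases with
      | zero =>
        simp only [Fin.cons_succ, Fin.cons_zero]
        exact hj.trans (by have : (0 : ℝ) ≤ (j : ℕ) := by positivity
                           nlinarith)
      | succ i =>
        simp only [Fin.cons_succ]
        have hi := (ha i).1
        have : ((i : ℕ) : ℝ) + 1 ≤ (j : ℕ) := by exact_mod_cast Fin.succ_lt_succ_iff.1 hij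
        nlinarith
  · intro k
    induction k using Fin.cases with
    | zero => simp [polyP_eq]
    | succ k => exact ha0 k

lemma polyP_eq_prod {N : ℕ} {mu : ℝ} {α : Fin (N + 1) → ℝ} (hα : Function.Injective α)
    (h0 : ∀ k, (polyP N mu).eval (α k) = 0) :
    polyP N mu = C 2 * ∏ k, (X - C (α k)) := by
  obtain ⟨hPd, hPc⟩ := polyP_natDegree_coeff N mu
  have hm : (∏ k, (X - C (α k))).Monic := monic_prod_of_monic _ _ fun _ _ => monic_X_sub_C _
  have hd : (∏ k, (X - C (α k))).natDegree = N + 1 := by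
    rw [natDegree_prod_of_monic _ _ fun _ _ => monic_X_sub_C _]
    simp
  refine eq_of_degree_sub_lt_of_eval_index_eq (s := Finset.univ) (v := α) hα.injOn ?_ ?_
  · rw [Finset.card_fin]
    refine degree_sub_lt_of_coeff hPd ((natDegree_C_mul_le _ _).trans hd.le) ?_
    have := hm.coeff_natDegree
    rw [hd] at this
    rw [hPc, coeff_C_mul, this, mul_one]
  · intro k _
    rw [h0, eval_mul, eval_prod, Finset.prod_eq_zero (Finset.mem_univ k) (by simp), mul_zero]

lemma polyP_roots {N : ℕ} {mu : ℝ} {α : Fin (N + 1) → ℝ} (hα : Function.Injective α)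
    (h0 : ∀ k, (polyP N mu).eval (α k) = 0) :
    (polyP N mu).roots = Finset.univ.val.map α := by
  rw [polyP_eq_prod hα h0, roots_C_mul _ two_ne_zero]
  have h := roots_multiset_prod_X_sub_C (Finset.univ.val.map α)
  rwa [Multiset.map_map] at h

lemma tendsto_polyP_div {N : ℕ} {mu : ℝ} {α : Fin (N + 1) → ℝ} (hα : Function.Injective α)
    (h0 : ∀ k, (polyP N mu).eval (α k) = 0) (k : Fin (N + 1)) :
    Tendsto (fun η : ℝ => (polyP N mu).eval η / (η - α k)) (𝓝[≠] (α k))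
      (𝓝 (2 * ∏ s ∈ Finset.univ.erase k, (α k - α s))) := by
  have hc : Continuous fun η : ℝ => 2 * ∏ s ∈ Finset.univ.erase k, (η - α s) := by fun_prop
  refine ((hc.tendsto (α k)).mono_left nhdsWithin_le_nhds).congr' ?_
  filter_upwards [self_mem_nhdsWithin] with η hη
  rw [eq_div_iff (sub_ne_zero.2 hη), polyP_eq_prod hα h0, eval_mul, eval_C, eval_prod,
    ← Finset.mul_prod_erase _ _ (Finset.mem_univ k)]
  simp only [eval_sub, eval_X, eval_C]
  ring

/-- `β 0 = P'(0)`. -/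
lemma two_mul_prod_neg_eq {N : ℕ} {mu : ℝ} {α : Fin (N + 1) → ℝ} (hα : Function.Injective α)
    (h0 : ∀ k, (polyP N mu).eval (α k) = 0) (hα0 : α 0 = 0) :
    2 * ∏ s ∈ Finset.univ.erase 0, (α 0 - α s) = (polyQ N mu).eval 0 +
      ∏ r ∈ Finset.range N, (2 * mu * (2 * (r : ℝ) + 2)) := by
  refine tendsto_nhds_unique (tendsto_polyP_div hα h0 0) ?_
  rw [hα0]
  have hc : Continuous fun η : ℝ => (polyQ N mu).eval η +
      ∏ r ∈ Finset.range N, (η + 2 * mu * (2 * (r : ℝ) + 2)) := by fun_prop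
  have h := (hc.tendsto 0).mono_left (nhdsWithin_le_nhds (s := {0}ᶜ))
  simp only [zero_add] at h
  refine h.congr' ?_
  filter_upwards [self_mem_nhdsWithin] with η hη
  rw [sub_zero, eq_div_iff hη, polyP_eq, eval_mul, eval_X, eval_add, eval_prod]
  simp only [eval_add, eval_X, eval_C]
  ring

lemma prod_two_mul_add_two (N : ℕ) (mu : ℝ) :
    ∏ r ∈ Finset.range N, (2 * mu * (2 * (r : ℝ) + 2)) = (4 * mu) ^ N * N.factorial := by
  induction N with
  | zero => simp
  | succ n ih =>
    rw [Finset.prod_range_succ, ih, Nat.factorial_succ, pow_succ]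
    push_cast
    ring

lemma polyQ_eval_zero (N : ℕ) (mu : ℝ) :
    4 ^ N * (polyQ N mu).eval 0 = (4 * mu) ^ N * N.factorial * (2 * N).choose N := by
  have hQ : (polyQ N mu).eval 0 = ∏ r ∈ Finset.range N, (2 * mu * (2 * (r : ℝ) + 1)) := by
    simp only [polyQ, eval_prod, eval_add, eval_X, eval_C, zero_add]
  rw [hQ]
  induction N with
  | zero => simp
  | succ n ih =>
    have hc : ((n : ℝ) + 1) * ((2 * (n + 1)).choose (n + 1) : ℝ) =
        2 * (2 * n + 1) * ((2 * n).choose n : ℝ) := by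
      exact_mod_cast Nat.succ_mul_centralBinom_succ n
    rw [Finset.prod_range_succ, Nat.factorial_succ, pow_succ, pow_succ]
    push_cast
    linear_combination (8 * mu * (2 * n + 1)) * (ih (by
      simp only [polyQ, eval_prod, eval_add, eval_X, eval_C, zero_add])) -
      (4 * mu) ^ n * (4 * mu) * n.factorial * hc

lemma two_mul_eval_div {N : ℕ} {mu : ℝ} (hmu : 0 < mu) {α : Fin (N + 1) → ℝ}
    (hα : Function.Injective α) (h0 : ∀ k, (polyP N mu).eval (α k) = 0) (hα0 : α 0 = 0) :
    2 * ((polyQ N mu).eval (α 0) / (2 * ∏ s ∈ Finset.univ.erase 0, (α 0 - α s))) =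
      2 * ((2 * N).choose N : ℝ) / (((2 * N).choose N : ℝ) + 4 ^ N) := by
  rw [two_mul_prod_neg_eq hα h0 hα0, hα0, prod_two_mul_add_two]
  have hQ := polyQ_eval_zero N mu
  have h4 : (0 : ℝ) < 4 ^ N := by positivity
  have hf : 0 < (4 * mu) ^ N * (N.factorial : ℝ) := by positivity
  have hc : (0 : ℝ) ≤ ((2 * N).choose N : ℝ) := by positivity
  have hQ' : (polyQ N mu).eval 0 =
      (4 * mu) ^ N * N.factorial * (2 * N).choose N / 4 ^ N := by
    rw [eq_div_iff h4.ne']; linarith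
  rw [hQ']
  generalize (4 * mu) ^ N * (N.factorial : ℝ) = F at *
  generalize ((2 * N).choose N : ℝ) = c at *
  field_simp

lemma sqrt_pi_mul_factorial_div_Gamma (N : ℕ) :
    Real.sqrt Real.pi * (N.factorial : ℝ) / Real.Gamma ((N : ℝ) + 1 / 2) =
      4 ^ N / ((2 * N).choose N : ℝ) := by
  have hc (n : ℕ) : (0 : ℝ) < ((2 * n).choose n : ℝ) := by
    exact_mod_cast Nat.centralBinom_pos n
  have hG (n : ℕ) : 0 < Real.Gamma ((n : ℝ) + 1 / 2) := Real.Gamma_pos_of_pos (by positivity)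
  rw [div_eq_div_iff (hG N).ne' (hc N).ne']
  induction N with
  | zero =>
    simp only [Nat.cast_zero, zero_add, Real.Gamma_one_half_eq]
    simp
  | succ n ih =>
    have hcn : ((n : ℝ) + 1) * ((2 * (n + 1)).choose (n + 1) : ℝ) =
        2 * (2 * n + 1) * ((2 * n).choose n : ℝ) := by
      exact_mod_cast Nat.succ_mul_centralBinom_succ n
    have hGn : Real.Gamma (((n + 1 : ℕ) : ℝ) + 1 / 2) =
        ((n : ℝ) + 1 / 2) * Real.Gamma ((n : ℝ) + 1 / 2) := by
      rw [← Real.Gamma_add_one (by positivity)]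
      push_cast
      ring_nf
    rw [hGn, Nat.factorial_succ, pow_succ]
    push_cast at hcn ⊢
    linear_combination (2 * (2 * n + 1)) * ih + (√Real.pi * n.factorial) * hcn

lemma limit_eq_Gamma_form (N : ℕ) :
    2 * ((2 * N).choose N : ℝ) / (((2 * N).choose N : ℝ) + 4 ^ N) =
      2 / (1 + Real.sqrt Real.pi * (N.factorial : ℝ) / Real.Gamma ((N : ℝ) + 1 / 2)) := by
  have hc : (0 : ℝ) < ((2 * N).choose N : ℝ) := by exact_mod_cast Nat.centralBinom_pos N
  rw [sqrt_pi_mul_factorial_div_Gamma]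
  field_simp

end Roots

/-- Rate of the particle-count chain from `m` to `k`. -/
noncomputable def levelRate (N : ℕ) (mu : ℝ) (m k : ℕ) : ℝ :=
  (if m = k + 1 then mu * ((N : ℝ) + m) else 0) + (if m + 1 = k then mu * ((N : ℝ) - m) else 0)

/-- Generator of the particle-count chain. -/
noncomputable def levelGen (N : ℕ) (mu : ℝ) : Matrix (Fin (N + 1)) (Fin (N + 1)) ℝ := fun m k =>
  levelRate N mu m k - if m = k then ∑ k' : Fin (N + 1), levelRate N mu m k' else 0

open Polynomial in
/-- Numerators of the resolvent of the particle-count chain. -/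
noncomputable def resolventNum (N : ℕ) (mu : ℝ) (k : ℕ) : ℝ[X] :=
  C (2 * (N.descFactorial k : ℝ) * mu ^ k) * kraw N mu (N - k)

section Resolvent

open Polynomial

lemma sum_mul_levelRate (N : ℕ) (mu : ℝ) (f : ℕ → ℝ) (k : ℕ) :
    ∑ m : Fin (N + 1), f m * levelRate N mu m k =
      (if k + 1 ≤ N then f (k + 1) * (mu * (N + (k + 1))) else 0) +
        if 1 ≤ k ∧ k ≤ N + 1 then f (k - 1) * (mu * (N - (k - 1))) else 0 := by
  rw [Fin.sum_univ_eq_sum_range (fun m => f m * levelRate N mu m k) (N + 1)]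
  simp only [levelRate, mul_add, mul_ite, mul_zero, Finset.sum_add_distrib]
  congr 1
  · rw [Finset.sum_ite_eq']
    simp only [Finset.mem_range, Nat.lt_succ_iff]
    push_cast
    simp only [mul_add]
  · rcases k with _ | k
    · simp
    · simp only [Nat.add_right_cancel_iff]
      rw [Finset.sum_ite_eq']
      simp

lemma sum_levelRate (N : ℕ) (hN : 1 ≤ N) (mu : ℝ) (m : ℕ) (hm : m ≤ N) :
    ∑ k : Fin (N + 1), levelRate N mu m k = if m = 0 then mu * N else 2 * mu * N := by
  rw [Fin.sum_univ_eq_sum_range (fun k => levelRate N mu m k) (N + 1)]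
  simp only [levelRate, Finset.sum_add_distrib]
  rw [Finset.sum_ite_eq]
  have h2 : (if m + 1 ∈ Finset.range (N + 1) then mu * ((N : ℝ) - m) else 0) =
      mu * (N - m) := by
    rcases hm.eq_or_lt with rfl | hm
    · simp
    · rw [if_pos (by simpa using hm)]
  rw [h2]
  rcases m with _ | m
  · simp
  · simp only [Nat.add_right_cancel_iff]
    rw [Finset.sum_ite_eq, if_pos (by simp; omega), if_neg (by omega)]
    ring

lemma resolventNum_zero (N : ℕ) {mu : ℝ} (hmu : 0 < mu) :
    resolventNum N mu 0 = C 2 * polyQ N mu := by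
  simp [resolventNum, kraw_middle N hmu]

lemma sum_resolventNum_mul_levelGen (N : ℕ) (hN : 1 ≤ N) {mu : ℝ} (hmu : 0 < mu) (x : ℝ)
    (k : Fin (N + 1)) :
    ∑ m : Fin (N + 1), (resolventNum N mu m).eval x * levelGen N mu m k =
      x * (resolventNum N mu k).eval x - if k = 0 then (polyP N mu).eval x else 0 := by
  simp only [levelGen, mul_sub, Finset.sum_sub_distrib, mul_ite, mul_zero, Finset.sum_ite_eq',
    Finset.mem_univ, if_true]
  rw [sum_mul_levelRate N mu (fun m => (resolventNum N mu m).eval x),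
    sum_levelRate N hN mu k k.is_le]
  obtain ⟨k, hk⟩ := k
  rcases k with _ | j
  · obtain ⟨n, rfl⟩ := Nat.exists_eq_add_of_le' hN
    rw [if_pos (by simp), if_neg (by simp), if_pos rfl,
      if_pos (c := (⟨0, hk⟩ : Fin (n + 1 + 1)) = 0) rfl, resolventNum_zero _ hmu,
      polyP_eq_kraw n hmu]
    simp [resolventNum]
    ring
  · obtain ⟨m, rfl⟩ := Nat.exists_eq_add_of_le' (Nat.lt_succ_iff.1 hk)
    simp only [Fin.mk_eq_zero, Nat.add_eq_zero_iff, one_ne_zero, and_false, if_false, sub_zero]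
    rw [if_pos (c := 1 ≤ j + 1 ∧ _) (by omega)]
    rcases m with _ | p
    · rw [if_neg (by omega)]
      simp only [resolventNum, eval_mul, eval_C, zero_add, Nat.descFactorial_succ]
      simp [kraw]
      ring
    · rw [if_pos (by omega)]
      simp only [resolventNum, eval_mul, eval_C, Nat.descFactorial_succ]
      rw [show p + 1 + (j + 1) - (j + 1 + 1) = p by omega,
        show p + 1 + (j + 1) - (j + 1) = p + 1 by omega,
        show p + 1 + (j + 1) - (j + 1 - 1) = p + 2 by omega]
      rw [show j + 1 - 1 = j by omega, show p + 1 + (j + 1) - j = p + 2 by omega]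
      simp only [kraw, eval_sub, eval_mul, eval_add, eval_X, eval_C]
      push_cast
      ring

lemma sum_resolventNum_div {N : ℕ} {mu : ℝ} (hmu : 0 < mu) {α : Fin (N + 1) → ℝ}
    (hα : Function.Injective α) (k : Fin (N + 1)) :
    ∑ j, (resolventNum N mu k).eval (α j) / (2 * ∏ s ∈ Finset.univ.erase j, (α j - α s)) =
      if k = 0 then 1 else 0 := by
  have hd : (resolventNum N mu k).natDegree ≤ N - k :=
    (natDegree_C_mul_le _ _).trans (kraw_natDegree ..).le
  have h := Lagrange.coeff_eq_sum (s := Finset.univ) (v := α) hα.injOn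
    (P := resolventNum N mu k) (by
      rw [Finset.card_fin]
      exact degree_le_natDegree.trans_lt (by exact_mod_cast (by omega)))
  rw [Finset.card_fin, Nat.add_sub_cancel] at h
  have h2 : ∑ j, (resolventNum N mu k).eval (α j) /
      (2 * ∏ s ∈ Finset.univ.erase j, (α j - α s)) = (resolventNum N mu k).coeff N / 2 := by
    rw [h, Finset.sum_div]
    refine Finset.sum_congr rfl fun j _ => ?_
    rw [div_div, mul_comm 2]
  rw [h2]
  split_ifs with hk
  · subst hk
    have := (polyQ_monic N mu).coeff_natDegree
    rw [polyQ_natDegree] at this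
    rw [Fin.val_zero, resolventNum_zero N hmu, coeff_C_mul, this]
    norm_num
  · have : (k : ℕ) ≠ 0 := fun h => hk (Fin.ext h)
    rw [coeff_eq_zero_of_natDegree_lt (by omega), zero_div]

/-- The spectral formula solves the forward equations of the particle-count chain. -/
lemma hasDerivAt_spectral {N : ℕ} (hN : 1 ≤ N) {mu : ℝ} (hmu : 0 < mu) {α : Fin (N + 1) → ℝ}
    (h0 : ∀ k, (polyP N mu).eval (α k) = 0) (β : Fin (N + 1) → ℝ) (t : ℝ) :
    HasDerivAt (fun t : ℝ => fun k : Fin (N + 1) =>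
        ∑ j, (resolventNum N mu k).eval (α j) / β j * Real.exp (α j * t))
      (Matrix.vecMul (fun k : Fin (N + 1) =>
        ∑ j, (resolventNum N mu k).eval (α j) / β j * Real.exp (α j * t)) (levelGen N mu)) t := by
  rw [hasDerivAt_pi]
  intro k
  have hd : HasDerivAt (fun t : ℝ =>
      ∑ j, (resolventNum N mu k).eval (α j) / β j * Real.exp (α j * t))
      (∑ j, (resolventNum N mu k).eval (α j) / β j * (Real.exp (α j * t) * (α j * 1))) t :=
    HasDerivAt.fun_sum fun j _ => (((hasDerivAt_id t).const_mul (α j)).exp).const_mul _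
  refine hd.congr_deriv (Eq.symm ?_)
  simp only [Matrix.vecMul, dotProduct, Finset.sum_mul]
  rw [Finset.sum_comm]
  refine Finset.sum_congr rfl fun j _ => ?_
  have h := sum_resolventNum_mul_levelGen N hN hmu (α j) k
  rw [h0, ite_self, sub_zero] at h
  calc _ = (∑ m : Fin (N + 1), (resolventNum N mu m).eval (α j) * levelGen N mu m k) *
        (Real.exp (α j * t) / β j) := by
        rw [Finset.sum_mul]
        exact Finset.sum_congr rfl fun m _ => by ring
    _ = _ := by rw [h]; ring

end Resolvent

end MultiTypeEhrenfest

namespace MultiTypeEhrenfest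

section ForwardEquation

variable {S : Type*} [Fintype S] [DecidableEq S] {p : ℝ≥0 → S → ℝ} {K : ℝ≥0 → S → S → ℝ}
  {G : Matrix S S ℝ}

lemma hasDerivWithinAt_of_kernel
    (hK : ∀ t h y, p (t + h) y = ∑ x, p t x * K h x y)
    (hG : ∀ x y, Tendsto (fun h : ℝ≥0 => (K h x y - if x = y then 1 else 0) / (h : ℝ))
      (𝓝[>] 0) (𝓝 (G x y))) {t : ℝ} (ht : 0 ≤ t) :
    HasDerivWithinAt (fun t : ℝ => p t.toNNReal) (Matrix.vecMul (p t.toNNReal) G)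
      (Set.Ici t) t := by
  rw [hasDerivWithinAt_pi]
  intro y
  rw [hasDerivWithinAt_iff_tendsto_slope, Set.Ici_sdiff_left]
  have hshift : Tendsto (fun s : ℝ => (s - t).toNNReal) (𝓝[>] t) (𝓝[>] 0) := by
    refine tendsto_nhdsWithin_iff.2 ⟨?_, ?_⟩
    · have hc : Continuous fun s : ℝ => (s - t).toNNReal := by fun_prop
      have := (hc.tendsto t).mono_left (nhdsWithin_le_nhds (s := Set.Ioi t))
      simpa using this
    · filter_upwards [self_mem_nhdsWithin] with s hs
      exact Real.toNNReal_pos.2 (sub_pos.2 hs)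
  have hlim := tendsto_finsetSum Finset.univ fun x (_ : x ∈ Finset.univ) =>
    ((hG x y).comp hshift).const_mul (p t.toNNReal x)
  refine hlim.congr' ?_
  filter_upwards [self_mem_nhdsWithin] with s hs
  have hs' : (0 : ℝ) < s - t := sub_pos.2 hs
  have hadd : s.toNNReal = t.toNNReal + (s - t).toNNReal := by
    rw [← Real.toNNReal_add ht hs'.le, add_sub_cancel]
  rw [slope_def_field, hadd, hK]
  have h1 : p t.toNNReal y = ∑ x, p t.toNNReal x * if x = y then 1 else 0 := by simp
  conv_rhs => rw [h1]
  rw [← Finset.sum_sub_distrib, Finset.sum_div]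
  refine Finset.sum_congr rfl fun x _ => ?_
  simp only [Function.comp_apply, Real.coe_toNNReal _ hs'.le]
  ring

lemma continuous_of_kernel (hp : ∀ t x, |p t x| ≤ 1)
    (hK : ∀ t h y, p (t + h) y = ∑ x, p t x * K h x y)
    (hG : ∀ x y, Tendsto (fun h : ℝ≥0 => (K h x y - if x = y then 1 else 0) / (h : ℝ))
      (𝓝[>] 0) (𝓝 (G x y))) : Continuous p := by
  refine continuous_pi fun y => ?_
  have hcoe : Tendsto (fun h : ℝ≥0 => (h : ℝ)) (𝓝[>] 0) (𝓝 0) :=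
    (NNReal.continuous_coe.tendsto 0).mono_left nhdsWithin_le_nhds
  have hω : Tendsto (fun h : ℝ≥0 => ∑ x, |K h x y - if x = y then 1 else 0|) (𝓝[>] 0) (𝓝 0) := by
    have : Tendsto (fun h : ℝ≥0 =>
        ∑ x, |(K h x y - if x = y then 1 else 0) / (h : ℝ) * (h : ℝ)|) (𝓝[>] 0)
        (𝓝 (∑ x, |G x y * 0|)) :=
      tendsto_finsetSum _ fun x _ => ((hG x y).mul hcoe).abs
    simp only [mul_zero, abs_zero, Finset.sum_const_zero] at this
    refine this.congr' ?_
    filter_upwards [self_mem_nhdsWithin] with h hh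
    have : (h : ℝ) ≠ 0 := by exact_mod_cast (show 0 < h from hh).ne'
    simp only [div_mul_cancel₀ _ this]
  have hbound (t h : ℝ≥0) :
      |p (t + h) y - p t y| ≤ ∑ x, |K h x y - if x = y then 1 else 0| := by
    have h1 : p t y = ∑ x, p t x * if x = y then 1 else 0 := by simp
    rw [hK, h1, ← Finset.sum_sub_distrib]
    refine (Finset.abs_sum_le_sum_abs _ _).trans (Finset.sum_le_sum fun x _ => ?_)
    rw [← mul_sub, abs_mul]
    exact mul_le_of_le_one_left (abs_nonneg _) (hp t x)
  refine UniformContinuous.continuous (Metric.uniformContinuous_iff.2 fun ε hε => ?_)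
  obtain ⟨δ, hδ, hsub⟩ := Metric.mem_nhdsWithin_iff.1 (hω.eventually (gt_mem_nhds hε))
  have hlt (s t : ℝ≥0) (hst : s < t) (hd : dist s t < δ) : dist (p s y) (p t y) < ε := by
    obtain ⟨h, rfl⟩ := exists_add_of_le hst.le
    have hpos : 0 < h := by simpa using hst
    rw [dist_comm, Real.dist_eq]
    refine (hbound s h).trans_lt (hsub ⟨?_, hpos⟩)
    rw [NNReal.dist_eq] at hd
    rw [Metric.mem_ball, NNReal.dist_eq]
    simpa using hd
  refine ⟨δ, hδ, fun {s t} hd => ?_⟩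
  rcases lt_trichotomy s t with h | rfl | h
  · exact hlt s t h hd
  · simpa using hε
  · rw [dist_comm] at hd ⊢
    exact hlt t s h hd

end ForwardEquation

variable {N d : ℕ} {lam mu : ℝ} {c : Matrix (Fin d) (Fin d) ℝ}

/-- Generator of the multi-type chain. -/
noncomputable def chainGen (lam mu : ℝ) (c : Matrix (Fin d) (Fin d) ℝ) :
    Matrix (State N d) (State N d) ℝ := fun x y =>
  rate lam mu c x y - if x = y then ∑ z, rate lam mu c x z else 0

lemma sum_rate (hlm : lam = mu) (hc_sum : ∀ l, ∑ j, c l j = 1) (x : State N d)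
    (k : Fin (N + 1)) : ∑ j, rate lam mu c x (k, j) = levelRate N mu x.1 k := by
  subst hlm
  obtain ⟨⟨m, hm⟩, l⟩ := x
  simp only [rate, levelRate]
  rcases m with _ | m
  · simp only [if_true, zero_add]
    rw [if_neg (by omega), zero_add]
    by_cases hk : (k : ℕ) = 1
    · simp only [hk, if_true]
      rw [← Finset.sum_mul, ← Finset.sum_mul, hc_sum]
      simp
    · simp [hk, Ne.symm hk]
  · simp only [Nat.add_eq_zero_iff, one_ne_zero, and_false, if_false, Finset.sum_ite_eq',
      Finset.mem_univ, if_true]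
    split_ifs <;> first | omega | simp

lemma sum_chainGen (hlm : lam = mu) (hc_sum : ∀ l, ∑ j, c l j = 1) (x : State N d)
    (k : Fin (N + 1)) : ∑ j, chainGen lam mu c x (k, j) = levelGen N mu x.1 k := by
  simp only [chainGen, levelGen, Finset.sum_sub_distrib, sum_rate hlm hc_sum,
    Fintype.sum_prod_type]
  congr 1
  obtain ⟨m, l⟩ := x
  by_cases h : m = k
  · subst h
    simp
  · simp [h]

lemma rate_self (x : State N d) : rate lam mu c x x = 0 := by
  simp only [rate]
  split_ifs <;> first | omega | rfl

variable {Ω : Type*} [MeasurableSpace Ω] {Pr : Measure Ω} {X : ℝ≥0 → Ω → State N d}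

lemma sum_measureReal_states {Y : Ω → State N d} (hY : Measurable Y) (μ : Measure Ω)
    [IsProbabilityMeasure μ] : ∑ y, μ.real {ω | Y ω = y} = 1 := by
  have h := sum_measureReal_preimage_singleton (μ := μ) (f := Y) Finset.univ
    fun y _ => hY (measurableSet_singleton y)
  rw [Finset.coe_univ, Set.preimage_univ, probReal_univ] at h
  exact h

lemma sum_measureReal_level {Y : Ω → State N d} (hY : Measurable Y) (μ : Measure Ω)
    [IsProbabilityMeasure μ] (k : Fin (N + 1)) :
    ∑ j, μ.real {ω | Y ω = (k, j)} = μ.real {ω | (Y ω).1 = k} := by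
  have h := sum_measureReal_preimage_singleton (μ := μ) (f := Y)
    (Finset.univ.map ⟨fun j : Fin d => (k, j), Prod.mk_right_injective k⟩)
    fun y _ => hY (measurableSet_singleton y)
  rw [Finset.sum_map] at h
  refine Eq.trans h (congrArg μ.real ?_)
  ext ω
  simp [Prod.ext_iff, eq_comm]

/-- The chain has transition kernels which do not depend on the present time, and whose derivative
at `0` is the generator. -/
lemma IsChain.exists_kernel [IsProbabilityMeasure Pr] (hX : IsChain lam mu c Pr X)
    (x₀ : State N d) (hx₀ : Pr {ω | X 0 ω = x₀} ≠ 0) :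
    ∃ K : ℝ≥0 → State N d → State N d → ℝ,
      (∀ t h y, (cond Pr {ω | X 0 ω = x₀}).real {ω | X (t + h) ω = y} =
        ∑ x, (cond Pr {ω | X 0 ω = x₀}).real {ω | X t ω = x} * K h x y) ∧
      ∀ x y, Tendsto (fun h : ℝ≥0 => (K h x y - if x = y then 1 else 0) / (h : ℝ))
        (𝓝[>] 0) (𝓝 (chainGen lam mu c x y)) := by
  classical
  have hms (t : ℝ≥0) (x : State N d) : MeasurableSet {ω | X t ω = x} :=
    hX.measurable t (measurableSet_singleton x)
  have hPc : IsProbabilityMeasure (cond Pr {ω | X 0 ω = x₀}) := cond_isProbabilityMeasure hx₀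
  refine ⟨fun h x y => if hx : ∃ t, Pr {ω | X t ω = x} ≠ 0 then
      (cond Pr {ω | X hx.choose ω = x}).real {ω | X (hx.choose + h) ω = y}
    else (if x = y then 1 else 0) + h * chainGen lam mu c x y, ?_, ?_⟩
  · intro t h y
    have htot := congrArg (fun μ : Measure Ω => μ.real {ω | X (t + h) ω = y})
      (sum_meas_smul_cond_fiber (hX.measurable t) (cond Pr {ω | X 0 ω = x₀}))
    simp only [measureReal_def, Measure.coe_finsetSum, Finset.sum_apply, Measure.smul_apply,
      smul_eq_mul] at htot
    rw [ENNReal.toReal_sum (fun x _ => by finiteness)] at htot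
    simp only [ENNReal.toReal_mul, ← measureReal_def] at htot
    rw [← htot]
    refine Finset.sum_congr rfl fun x _ => ?_
    change (cond Pr {ω | X 0 ω = x₀}).real {ω | X t ω = x} *
      (cond (cond Pr {ω | X 0 ω = x₀}) {ω | X t ω = x}).real _ = _
    rw [cond_cond_eq_cond_inter (hms 0 x₀) (hms t x)]
    by_cases h0 : Pr ({ω | X 0 ω = x₀} ∩ {ω | X t ω = x}) = 0
    · have : (cond Pr {ω | X 0 ω = x₀}).real {ω | X t ω = x} = 0 := by
        rw [measureReal_def, cond_apply (hms 0 x₀), h0]; simp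
      rw [this, zero_mul, zero_mul]
    · have hxt : Pr {ω | X t ω = x} ≠ 0 := fun h => h0 (measure_inter_null_of_null_right _ h)
      have hx : ∃ t, Pr {ω | X t ω = x} ≠ 0 := ⟨t, hxt⟩
      simp only [dif_pos hx]
      congr 1
      have hset : {ω | X t ω = x} ∩ {ω | ∀ _ : Fin 1, X 0 ω = x₀} =
          {ω | X 0 ω = x₀} ∩ {ω | X t ω = x} := by
        ext ω; simp [and_comm]
      have hm := hX.markov 1 (fun _ => 0) t h (fun _ => x₀) x y (fun _ => zero_le)
      rw [hset] at hm
      rw [hm h0]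
      exact hX.homogeneous t hx.choose h x y hxt hx.choose_spec
  · intro x y
    by_cases hx : ∃ t, Pr {ω | X t ω = x} ≠ 0
    · simp only [dif_pos hx]
      have hP : IsProbabilityMeasure (cond Pr {ω | X hx.choose ω = x}) :=
        cond_isProbabilityMeasure hx.choose_spec
      have hr (z : State N d) (hz : x ≠ z) := hX.rates hx.choose x z hz hx.choose_spec
      by_cases hxy : x = y
      · subst hxy
        simp only [if_true, chainGen]
        have hlim := (tendsto_finsetSum (Finset.univ.erase x) fun z hz =>
          hr z (Finset.ne_of_mem_erase hz).symm).neg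
        rw [← Finset.add_sum_erase Finset.univ _ (Finset.mem_univ x), rate_self, zero_add, zero_sub]
        refine hlim.congr fun h => ?_
        rw [← Finset.sum_div, ← neg_div]
        congr 1
        have := sum_measureReal_states (hX.measurable (hx.choose + h))
          (cond Pr {ω | X hx.choose ω = x})
        rw [← Finset.add_sum_erase Finset.univ _ (Finset.mem_univ x)] at this
        linarith
      · simpa [hxy, chainGen] using hr y hxy
    · simp only [dif_neg hx]
      refine tendsto_const_nhds.congr' ?_
      filter_upwards [self_mem_nhdsWithin] with h hh
      have : (h : ℝ) ≠ 0 := by exact_mod_cast (show 0 < h from hh).ne'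
      field_simp
      ring

/-- The law of the number of particles solves the forward equations of the particle-count chain. -/
lemma IsChain.level_forward [IsProbabilityMeasure Pr] (hX : IsChain lam mu c Pr X)
    (hlm : lam = mu) (hc_sum : ∀ l, ∑ j, c l j = 1)
    (x₀ : State N d) (hx₀ : Pr {ω | X 0 ω = x₀} ≠ 0) :
    (Continuous fun (t : ℝ≥0) (k : Fin (N + 1)) =>
      (cond Pr {ω | X 0 ω = x₀}).real {ω | (X t ω).1 = k}) ∧
    ∀ t : ℝ, 0 ≤ t → HasDerivWithinAt (fun (t : ℝ) (k : Fin (N + 1)) =>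
        (cond Pr {ω | X 0 ω = x₀}).real {ω | (X t.toNNReal ω).1 = k})
      (Matrix.vecMul (fun k : Fin (N + 1) =>
        (cond Pr {ω | X 0 ω = x₀}).real {ω | (X t.toNNReal ω).1 = k}) (levelGen N mu))
      (Set.Ici t) t := by
  obtain ⟨K, hK, hG⟩ := hX.exists_kernel x₀ hx₀
  have hPc : IsProbabilityMeasure (cond Pr {ω | X 0 ω = x₀}) := cond_isProbabilityMeasure hx₀
  set p : ℝ≥0 → State N d → ℝ := fun t x => (cond Pr {ω | X 0 ω = x₀}).real {ω | X t ω = x}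
    with hp
  have hcont : Continuous p := continuous_of_kernel (K := K)
    (fun t x => by rw [abs_of_nonneg measureReal_nonneg]; exact measureReal_le_one) hK hG
  simp only [← sum_measureReal_level (hX.measurable _)]
  refine ⟨continuous_pi fun k => continuous_finsetSum _ fun j _ =>
    (continuous_apply (k, j)).comp hcont, fun t ht => ?_⟩
  have hd := hasDerivWithinAt_of_kernel (p := p) hK hG ht
  rw [hasDerivWithinAt_pi] at hd ⊢
  intro k
  have hs := HasDerivWithinAt.fun_sum fun j (_ : j ∈ Finset.univ) => hd (k, j)
  refine hs.congr_deriv (Eq.symm ?_)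
  simp only [Matrix.vecMul, dotProduct]
  rw [Finset.sum_comm]
  simp only [← Finset.mul_sum, sum_chainGen hlm hc_sum]
  rw [Fintype.sum_prod_type]
  simp only [Finset.sum_mul, hp]

lemma IsChain.emptyProb_eq [IsProbabilityMeasure Pr] (hX : IsChain lam mu c Pr X)
    (hN : 1 ≤ N) (hmu : 0 < mu) (hlm : lam = mu) (hc_sum : ∀ l, ∑ j, c l j = 1)
    (l₀ : Fin d) (hl₀ : Pr {ω | X 0 ω = (0, l₀)} ≠ 0) {α : Fin (N + 1) → ℝ}
    (hα : Function.Injective α) (h0 : ∀ k, (polyP N mu).eval (α k) = 0) (t : ℝ≥0) :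
    emptyProb Pr X l₀ t = 2 * ∑ k, (polyQ N mu).eval (α k) /
      (2 * ∏ s ∈ Finset.univ.erase k, (α k - α s)) * Real.exp (α k * t) := by
  obtain ⟨hcont, hderiv⟩ := hX.level_forward hlm hc_sum (0, l₀) hl₀
  have hz := hasDerivAt_spectral hN hmu h0
    (fun k => 2 * ∏ s ∈ Finset.univ.erase k, (α k - α s))
  have huniq := ODE_solution_unique (a := 0) (b := (t : ℝ))
    (v := fun _ y => Matrix.vecMul y (levelGen N mu))
    (fun _ => (LinearMap.toContinuousLinearMap
      (Matrix.vecMulLinear (levelGen N mu))).lipschitz)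
    (hcont.comp continuous_real_toNNReal).continuousOn
    (fun s hs => hderiv s hs.1)
    (fun s _ => (hz s).continuousAt.continuousWithinAt)
    (fun s _ => (hz s).hasDerivWithinAt) ?_
  · have h := congrFun (huniq (x := (t : ℝ)) ⟨t.coe_nonneg, le_rfl⟩) 0
    simp only [Function.comp_apply, Real.toNNReal_coe, Fin.val_zero,
      resolventNum_zero N hmu] at h
    rw [emptyProb, h, Finset.mul_sum]
    refine Finset.sum_congr rfl fun k _ => ?_
    rw [Polynomial.eval_mul, Polynomial.eval_C]
    ring
  · funext k
    simp only [Function.comp_apply, Real.toNNReal_zero, mul_zero, Real.exp_zero, mul_one]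
    rw [sum_resolventNum_div hmu hα k]
    have hm0 : MeasurableSet {ω | X 0 ω = (0, l₀)} :=
      hX.measurable 0 (measurableSet_singleton _)
    rw [measureReal_def, cond_apply hm0]
    split_ifs with hk
    · subst hk
      rw [show {ω | X 0 ω = (0, l₀)} ∩ {ω | (X 0 ω).1 = 0} = {ω | X 0 ω = (0, l₀)} from
          Set.inter_eq_left.2 fun ω (hω : X 0 ω = (0, l₀)) => congrArg Prod.fst hω,
        ENNReal.inv_mul_cancel hl₀ (measure_ne_top _ _), ENNReal.toReal_one]
    · have : {ω | X 0 ω = (0, l₀)} ∩ {ω | (X 0 ω).1 = k} = ∅ := by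
        ext ω
        simp only [Set.mem_inter_iff, Set.mem_ofPred_eq, Set.mem_empty_iff_false, iff_false, not_and]
        intro hω h
        rw [hω] at h
        exact hk h.symm
      simp [this]

end MultiTypeEhrenfest

theorem mainTheorem3 (N d : ℕ) (hN : 1 ≤ N) (lam mu : ℝ) (hlam : 0 < lam) (hmu : 0 < mu)
    (hlm : lam = mu)
    (c : Matrix (Fin d) (Fin d) ℝ) (hc_nonneg : ∀ l j, 0 ≤ c l j) (hc_sum : ∀ l, ∑ j, c l j = 1)
    {Ω : Type*} [MeasurableSpace Ω] (Pr : Measure Ω) [IsProbabilityMeasure Pr]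
    (X : ℝ≥0 → Ω → MultiTypeEhrenfest.State N d)
    (hX : MultiTypeEhrenfest.IsChain lam mu c Pr X)
    (l₀ : Fin d) (hl₀ : Pr {ω | X 0 ω = (0, l₀)} ≠ 0) :
    ∃ (ρ₀ : ℝ) (α β : Fin (N + 1) → ℝ),
      -- the limit `ρ(0)` and its two closed forms
      Tendsto (fun t : ℝ≥0 => MultiTypeEhrenfest.emptyProb Pr X l₀ t) atTop (𝓝 ρ₀) ∧
      ρ₀ = 2 * ((2 * N).choose N : ℝ) / (((2 * N).choose N : ℝ) + 4 ^ N) ∧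
      ρ₀ = 2 / (1 + Real.sqrt Real.pi * (N.factorial : ℝ) / Real.Gamma ((N : ℝ) + 1 / 2)) ∧
      -- `0 = α 0 > α 1 > … > α N` are the roots of `P`, with multiplicity
      α 0 = 0 ∧ StrictAnti α ∧
      (MultiTypeEhrenfest.polyP N mu).roots = Finset.univ.val.map α ∧
      -- the coefficients `β`
      (∀ k, Tendsto (fun η : ℝ => (MultiTypeEhrenfest.polyP N mu).eval η / (η - α k))
        (𝓝[≠] (α k)) (𝓝 (β k))) ∧
      (∀ k, β k = 2 * ∏ s ∈ Finset.univ.erase k, (α k - α s)) ∧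
      -- the probability of an empty system
      ∀ t : ℝ≥0, MultiTypeEhrenfest.emptyProb Pr X l₀ t =
        ρ₀ + 2 * ∑ k : Fin N, (MultiTypeEhrenfest.polyQ N mu).eval (α k.succ) / β k.succ *
          Real.exp (α k.succ * (t : ℝ)) := by
  obtain ⟨α, hα0, hanti, h0⟩ := MultiTypeEhrenfest.exists_strictAnti_roots N hmu
  have hinj := hanti.injective
  have hformula (t : ℝ≥0) : MultiTypeEhrenfest.emptyProb Pr X l₀ t =
      2 * ((2 * N).choose N : ℝ) / (((2 * N).choose N : ℝ) + 4 ^ N) +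
        2 * ∑ k : Fin N, (MultiTypeEhrenfest.polyQ N mu).eval (α k.succ) /
          (2 * ∏ s ∈ Finset.univ.erase k.succ, (α k.succ - α s)) *
            Real.exp (α k.succ * (t : ℝ)) := by
    rw [hX.emptyProb_eq hN hmu hlm hc_sum l₀ hl₀ hinj h0 t, Fin.sum_univ_succ, mul_add,
      ← MultiTypeEhrenfest.two_mul_eval_div hmu hinj h0 hα0]
    rw [show α 0 * (t : ℝ) = 0 by rw [hα0, zero_mul], Real.exp_zero, mul_one]
  refine ⟨_, α, _, ?_, rfl, MultiTypeEhrenfest.limit_eq_Gamma_form N, hα0, hanti,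
    MultiTypeEhrenfest.polyP_roots hinj h0, MultiTypeEhrenfest.tendsto_polyP_div hinj h0,
    fun _ => rfl, hformula⟩
  have hexp (k : Fin N) : Tendsto (fun t : ℝ≥0 => Real.exp (α k.succ * (t : ℝ))) atTop (𝓝 0) := by
    have hneg : α k.succ < 0 := hα0 ▸ hanti (Fin.succ_pos k)
    exact Real.tendsto_exp_atBot.comp
      ((tendsto_const_mul_atBot_of_neg hneg).2 (NNReal.tendsto_coe_atTop.2 tendsto_id))
  have hlim := ((tendsto_finsetSum Finset.univ fun k (_ : k ∈ Finset.univ) =>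
    (hexp k).const_mul ((MultiTypeEhrenfest.polyQ N mu).eval (α k.succ) /
      (2 * ∏ s ∈ Finset.univ.erase k.succ, (α k.succ - α s)))).const_mul 2).const_add
    (2 * ((2 * N).choose N : ℝ) / (((2 * N).choose N : ℝ) + 4 ^ N))
  simp only [mul_zero, Finset.sum_const_zero, add_zero] at hlim
  exact hlim.congr fun t => (hformula t).symm
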